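/- Let the field of scalars be $\mathbb K=\mathbb R$ or $\mathbb K=\mathbb C$. For a topological space $X$ let $C_b(X)$ be the algebra of bounded continuous functions $f:X\to\mathbb K$ with the supremum norm, let $\mathrm{Coz}(f)=\{x:f(x)\neq 0\}$, and let $\mathrm{supp}(f)=\mathrm{cl}_X\mathrm{Coz}(f)$. Let $C_c(X)$ be the set of $f\in C_b(X)$ with compact support, and let $C_0(X)$ be the set of $f\in C_b(X)$ such that $\{x:|f(x)|\ge\varepsilon\}$ is compact for every $\varepsilon>0$. Let $\mathscr P$ be the Lindelöf property, and let $C_{\mathscr P}(X)$ be the set of $f\in C_b(X)$ such that $\mathrm{supp}(f)$ has a Lindelöf neighborhood in $X$. The Lindelöf number of $X$ is $$\ell(X)=\min\{\mathfrak n:\text{every open cover of }X\text{ has a subcover of cardinality}\le\mathfrak n\}+\aleph_0 .$$ For $X$ completely regular Hausdorff with Stone–Čech compactification $\beta X$ put $$\lambda_{\mathscr P}X=\bigcup\{\mathrm{int}_{\beta X}\mathrm{cl}_{\beta X}\mathrm{Coz}(f): f\in C_b(X),\ \mathrm{cl}_X\mathrm{Coz}(f)\text{ is Lindelöf}\}\subseteq\beta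 X .$$ Theorem. Let $X$ be a metrizable space in which every point has a Lindelöf neighborhood, and let $Y=\lambda_{\mathscr P}X$ with the subspace topology from $\beta X$. Then $C_{\mathscr P}(X)$ is a Banach subalgebra of $C_b(X)$ (that is, a subalgebra, not necessarily unital, complete in the supremum norm), $Y$ is locally compact Hausdorff, $C_{\mathscr P}(X)$ is isometrically isomorphic, as a normed algebra, to $C_c(Y)$, and every locally compact Hausdorff space $T$ such that $C_{\mathscr P}(X)$ is isometrically isomorphic to $C_c(T)$ is homeomorphic to $Y$. Moreover: 1. $C_{\mathscr P}(X)=\{f\in C_b(X):\mathrm{supp}(f)\text{ is Lindelöf}\}$. 2. $C_0(X)\subseteq C_{\mathscr P}(X)$, and the inclusion is proper if $X$ is not Lindelöf. 3. $C_c(Y)=C_0(Y)$. 4. $Y$ is countably compact. 5. If $X$ is not Lindelöf, then $Y$ is not normal. 6. If $X$ is infinite, then $\dim C_{\mathscr P}(X)=\ell(X)^{\aleph_0}$, where $\dim$ is the (algebraic) vector space dimension over $\mathbb K$. -/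

import Mathlib

open Set Topology BoundedContinuousFunction
open scoped Cardinal

universe u v

/-- Every point has a Lindelöf neighborhood (not necessarily open or closed). -/
def IsLocallyLindelof (X : Type u) [TopologicalSpace X] : Prop :=
  ∀ x : X, ∃ U ∈ 𝓝 x, IsLindelof U

section Algebras

variable (𝕜 : Type) [RCLike 𝕜] (X : Type u) [TopologicalSpace X]

/-- `C_𝒫(X)` for `𝒫` the Lindelöf property: the bounded continuous scalar-valued functions whose
support (the closure of the cozero-set) has a Lindelöf neighborhood, as a (not necessarily unital)
subalgebra of `C_b(X)`. -/
def lindelofSupported : NonUnitalSubalgebra 𝕜 (X →ᵇ 𝕜) where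
  carrier := {f | ∃ U ∈ 𝓝ˢ (tsupport f), IsLindelof U}
  zero_mem' := ⟨∅, by simp [tsupport], isLindelof_empty⟩
  add_mem' := by
    rintro f g ⟨U, hU, hUL⟩ ⟨V, hV, hVL⟩
    refine ⟨U ∪ V, ?_, hUL.union hVL⟩
    exact nhdsSet_mono (tsupport_add (⇑f) (⇑g)) (union_mem_nhdsSet hU hV)
  mul_mem' := by
    rintro f g ⟨U, hU, hUL⟩ -
    exact ⟨U, nhdsSet_mono (tsupport_mul_subset_left (f := ⇑f) (g := ⇑g)) hU, hUL⟩
  smul_mem' := by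
    rintro c f ⟨U, hU, hUL⟩
    exact ⟨U, nhdsSet_mono (tsupport_smul_subset_right (fun _ => c) (⇑f)) hU, hUL⟩

/-- `C_c(X)`: the bounded continuous functions with compact support, as a subalgebra of `C_b(X)`
(with the supremum norm). -/
def compactSupported : NonUnitalSubalgebra 𝕜 (X →ᵇ 𝕜) where
  carrier := {f | IsCompact (tsupport f)}
  zero_mem' := by simp [tsupport]
  add_mem' := by
    intro f g hf hg
    exact (hf.union hg).of_isClosed_subset (isClosed_tsupport _) (tsupport_add (⇑f) (⇑g))
  mul_mem' := by
    intro f g hf _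
    exact hf.of_isClosed_subset (isClosed_tsupport _)
      (tsupport_mul_subset_left (f := ⇑f) (g := ⇑g))
  smul_mem' := by
    intro c f hf
    exact hf.of_isClosed_subset (isClosed_tsupport _)
      (tsupport_smul_subset_right (fun _ => c) (⇑f))

/-- `C_0(X)`: the bounded continuous functions vanishing at infinity. -/
def vanishingAtInfinity : Set (X →ᵇ 𝕜) :=
  {f | ∀ ε : ℝ, 0 < ε → IsCompact {x | ε ≤ ‖f x‖}}

/-- `λ_𝒫 X` for `𝒫` the Lindelöf property: the union of the sets `int cl C` (interior and closure
taken in the Stone–Čech compactification `βX`) over all cozero-sets `C` of `X` whose closure in `X`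
is Lindelöf. -/
def lambdaLindelof : Set (StoneCech X) :=
  ⋃ f ∈ {f : X →ᵇ 𝕜 | IsLindelof (closure (Function.support f))},
    interior (closure (stoneCechUnit '' Function.support f))

end Algebras

/-- Two (not necessarily unital) normed `𝕜`-algebras are isometrically isomorphic: there is a
norm-preserving bijective algebra homomorphism between them. -/
def IsometricallyIsomorphic (𝕜 : Type) [RCLike 𝕜] (A : Type u) (B : Type v)
    [NonUnitalNormedRing A] [Module 𝕜 A] [NonUnitalNormedRing B] [Module 𝕜 B] : Prop :=
  ∃ φ : A →ₙₐ[𝕜] B, Function.Bijective φ ∧ ∀ a : A, ‖φ a‖ = ‖a‖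

/-- The Lindelöf number `ℓ(X)`: the least cardinal `n` such that every open cover of `X` has a
subcover of cardinality at most `n`, plus `ℵ₀`. -/
noncomputable def lindelofNumber (X : Type u) [TopologicalSpace X] : Cardinal.{u} :=
  sInf {n : Cardinal.{u} | ∀ 𝒰 : Set (Set X), (∀ U ∈ 𝒰, IsOpen U) → ⋃₀ 𝒰 = univ →
    ∃ 𝒱 ⊆ 𝒰, ⋃₀ 𝒱 = univ ∧ #𝒱 ≤ n} + ℵ₀

/-! A metrizable locally Lindelöf space splits into clopen Lindelöf pieces, the fibers of a map `p :
X → I` that is continuous for the discrete topology on `I`. A set then has Lindelöf closure exactly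
when it meets countably many pieces, so `C_𝒫(X)` consists of the functions vanishing off countably
many pieces.

The map `p` extends to `βX → βI`, with `βI` the space of ultrafilters on `I`, and `Y` is the set of
points whose ultrafilter contains a countable set (`lambdaLindelof_eq`). The points lying over a
fixed countable `J` form a compact clopen subset of `Y`, and every compact subset of `Y` lies over
some countable `J`. Since countable unions of countable sets are countable, completeness of
`C_𝒫(X)`, `C_c(Y) = C_0(Y)` and countable compactness of `Y` follow at once. Stone–Čech extension
and restriction identify `C_𝒫(X)` with `C_c(Y)`, and uniqueness of `Y` is a Banach–Stone argument:
the nonzero characters of `C_c(T)` are the point evaluations.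

If `X` is not Lindelöf then `I` is uncountable, and an independent family of `ℵ₁` subsets of a
countable set lets the classical proof that `ω₁ × (ω₁ + 1)` is not normal be carried out inside `Y`
(`not_normalSpace_of_embedding`). For the dimension, `ℓ(X) = max #I ℵ₀`; the dimension is at least
`𝔠`, hence equals the cardinality of `C_𝒫(X)`, which is then counted. -/

/-! ### Clopen Lindelöf partitions and the structure of `λ X`. -/

section Partition

variable {X : Type u} [TopologicalSpace X]

theorem LocallyFinite.countable_inter_nonempty {ι : Type*} {v : ι → Set X} (hv : LocallyFinite v)
    {S : Set X} (hS : IsLindelof S) : {i | (v i ∩ S).Nonempty}.Countable := by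
  choose U hU hUf using hv
  obtain ⟨t, ht, -, hSt⟩ := hS.elim_nhds_subcover U fun x _ => hU x
  refine (ht.biUnion fun x _ => (hUf x).countable).mono ?_
  rintro i ⟨y, hyi, hyS⟩
  obtain ⟨x, hx, hyx⟩ := mem_iUnion₂.1 (hSt hyS)
  exact mem_iUnion₂.2 ⟨x, hx, y, hyi, hyx⟩

theorem Relation.countable_reflTransGen {α : Type*} {r : α → α → Prop}
    (h : ∀ a, {b | r a b}.Countable) (a : α) : {b | Relation.ReflTransGen r a b}.Countable := by
  let S : ℕ → Set α := fun n => n.rec {a} fun _ T => ⋃ b ∈ T, {c | r b c}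
  have hS : ∀ n, (S n).Countable := by
    intro n
    induction n with
    | zero => exact countable_singleton a
    | succ n ih => exact ih.biUnion fun b _ => h b
  refine (countable_iUnion hS).mono fun b hb => ?_
  induction hb with
  | refl => exact mem_iUnion.2 ⟨0, rfl⟩
  | @tail b c _ hbc ih =>
    obtain ⟨n, hn⟩ := mem_iUnion.1 ih
    exact mem_iUnion.2 ⟨n + 1, mem_iUnion₂.2 ⟨b, hn, hbc⟩⟩

/-- A partition of a space into (nonempty) clopen Lindelöf sets, given as the fibers of a map. -/
structure IsLindelofPartition {I : Type*} (p : X → I) : Prop where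
  surjective : Function.Surjective p
  isOpen_preimage : ∀ J : Set I, IsOpen (p ⁻¹' J)
  isLindelof_fiber : ∀ i, IsLindelof (p ⁻¹' {i})

/-- Take a locally finite open refinement `v` of a cover by interiors of Lindelöf sets, and join two
indices when their members meet. Each index has countably many neighbors, so the connected
components of this graph are countable. The union of the `v b` over a component is clopen, and is
closed inside a countable union of Lindelöf sets. -/
theorem IsLocallyLindelof.exists_partition [T2Space X] [ParacompactSpace X]
    (hX : IsLocallyLindelof X) : ∃ (I : Type u) (p : X → I), IsLindelofPartition p := by
  choose U hU hUL using hX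
  obtain ⟨v, vo, vc, vf, vU⟩ := precise_refinement (fun x => interior (U x))
    (fun x => isOpen_interior) (eq_univ_of_forall fun x =>
      mem_iUnion.2 ⟨x, mem_interior_iff_mem_nhds.2 (hU x)⟩)
  let r : X → X → Prop := fun a b => (v a ∩ v b).Nonempty
  have hr : Std.Symm r := ⟨fun a b h => by simpa only [r, inter_comm] using h⟩
  have hrc : ∀ a, {b | r a b}.Countable := fun a =>
    (vf.countable_inter_nonempty (hUL a)).mono <| by
      rintro b ⟨y, hya, hyb⟩
      exact ⟨y, hyb, interior_subset (vU a hya)⟩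
  let s : Setoid X :=
    ⟨Relation.ReflTransGen r, fun _ => .refl, fun h => Std.Symm.symm _ _ h, fun h h' => h.trans h'⟩
  have hv : ∀ x, ∃ a, x ∈ v a := fun x => mem_iUnion.1 (vc ▸ mem_univ x)
  choose a ha using hv
  let q : X → Quotient s := fun x => ⟦a x⟧
  have hq : ∀ b x, x ∈ v b → q x = ⟦b⟧ := fun b x hx =>
    Quotient.sound (Relation.ReflTransGen.single ⟨x, ha x, hx⟩)
  have hqo : ∀ J : Set (Quotient s), IsOpen (q ⁻¹' J) := by
    intro J
    have : q ⁻¹' J = ⋃ b ∈ {b : X | (⟦b⟧ : Quotient s) ∈ J}, v b := by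
      ext x
      simp only [mem_preimage, mem_iUnion, mem_ofPred_eq, exists_prop]
      refine ⟨fun h => ⟨a x, h, ha x⟩, ?_⟩
      rintro ⟨b, hb, hx⟩
      rwa [hq b x hx]
    rw [this]
    exact isOpen_biUnion fun b _ => vo b
  -- An index `b` with `v b` empty forms a class containing no `a x`; restricting to `range q`
  -- discards the resulting empty pieces.
  refine ⟨range q, rangeFactorization q, rangeFactorization_surjective, fun J => ?_, ?_⟩
  · convert hqo (Subtype.val '' J) using 1
    ext x
    simp [rangeFactorization]
  · rintro ⟨_, x, rfl⟩
    have h1 : rangeFactorization q ⁻¹' {⟨q x, x, rfl⟩} = q ⁻¹' {q x} := by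
      ext y
      exact Subtype.ext_iff
    rw [h1]
    have hL : IsLindelof (⋃ b ∈ {b | Relation.ReflTransGen r (a x) b}, U b) :=
      (Relation.countable_reflTransGen hrc (a x)).isLindelof_biUnion fun b _ => hUL b
    refine hL.of_isClosed_subset ?_ ?_
    · rw [← isOpen_compl_iff, ← preimage_compl]
      exact hqo _
    · intro y hy
      have : Relation.ReflTransGen r (a x) (a y) := Quotient.exact (Eq.symm hy)
      exact mem_iUnion₂.2 ⟨a y, this, interior_subset (vU _ (ha y))⟩

theorem isOpen_lambdaLindelof (𝕜 : Type) [RCLike 𝕜] : IsOpen (lambdaLindelof 𝕜 X) :=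
  isOpen_biUnion fun _ _ => isOpen_interior

namespace IsLindelofPartition

variable {I : Type*} {p : X → I}

theorem isClopen_preimage (hp : IsLindelofPartition p) (J : Set I) : IsClopen (p ⁻¹' J) :=
  ⟨by rw [← isOpen_compl_iff, ← preimage_compl]; exact hp.isOpen_preimage _, hp.isOpen_preimage J⟩

theorem isLindelof_preimage (hp : IsLindelofPartition p) {J : Set I} (hJ : J.Countable) :
    IsLindelof (p ⁻¹' J) := by
  rw [← biUnion_preimage_singleton]
  exact hJ.isLindelof_biUnion fun i _ => hp.isLindelof_fiber i

theorem countable_image (hp : IsLindelofPartition p) {S : Set X} (hS : IsLindelof S) :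
    (p '' S).Countable := by
  obtain ⟨t, ht, -, hSt⟩ := hS.elim_nhds_subcover (fun x => p ⁻¹' {p x})
    fun x _ => (hp.isOpen_preimage _).mem_nhds rfl
  refine (ht.image p).mono ?_
  rintro _ ⟨x, hx, rfl⟩
  obtain ⟨y, hy, hxy⟩ := mem_iUnion₂.1 (hSt hx)
  exact ⟨y, hy, Eq.symm hxy⟩

theorem isLindelof_closure_iff (hp : IsLindelofPartition p) {S : Set X} :
    IsLindelof (closure S) ↔ (p '' S).Countable := by
  constructor
  · exact fun h => (hp.countable_image h).mono (image_mono subset_closure)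
  · exact fun h => (hp.isLindelof_preimage h).of_isClosed_subset isClosed_closure
      (closure_minimal (subset_preimage_image p S) (hp.isClopen_preimage _).1)

theorem continuous_comp (hp : IsLindelofPartition p) {Z : Type*} [TopologicalSpace Z] (g : I → Z) :
    Continuous fun x => g (p x) :=
  ⟨fun s _ => hp.isOpen_preimage (g ⁻¹' s)⟩

theorem exists_countable_of_lindelof (hp : IsLindelofPartition p)
    {S : Set X} (hS : IsLindelof (closure S)) :
    ∃ J : Set I, J.Countable ∧ S ⊆ p ⁻¹' J :=
  ⟨_, hp.isLindelof_closure_iff.1 hS, subset_preimage_image p S⟩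

end IsLindelofPartition

/-! ### The extension `βX → βI` and compact subsets of `λ X`. -/

namespace IsLindelofPartition

variable {I : Type u} {p : X → I}

/-- The extension to the Stone-Čech compactification of the map from a space to the set of
pieces of a partition, with values in the ultrafilters on this set. -/
noncomputable def extend (hp : IsLindelofPartition p) : StoneCech X → Ultrafilter I :=
  stoneCechExtend (hp.continuous_comp (pure : I → Ultrafilter I))

theorem continuous_extend (hp : IsLindelofPartition p) : Continuous hp.extend :=
  continuous_stoneCechExtend _

@[simp]
theorem extend_unit (hp : IsLindelofPartition p) (x : X) :
    hp.extend (stoneCechUnit x) = pure (p x) :=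
  stoneCechExtend_stoneCechUnit _ x

theorem isClopen_extend (hp : IsLindelofPartition p) (J : Set I) : IsClopen {y | J ∈ hp.extend y} :=
  ⟨(ultrafilter_isClosed_basic J).preimage hp.continuous_extend,
    (ultrafilter_isOpen_basic J).preimage hp.continuous_extend⟩

/-- The right side is clopen, and `X` is dense in `βX`, hence dense in every open set. -/
theorem closure_image_preimage (hp : IsLindelofPartition p) (J : Set I) :
    closure (stoneCechUnit '' (p ⁻¹' J)) = {y | J ∈ hp.extend y} := by
  apply Subset.antisymm
  · refine closure_minimal ?_ (hp.isClopen_extend J).1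
    rintro _ ⟨x, hx, rfl⟩
    simpa using hx
  · intro y hy
    have := (hp.isClopen_extend J).2.inter_closure (t := range stoneCechUnit)
      ⟨hy, denseRange_stoneCechUnit y⟩
    refine closure_mono ?_ this
    rintro _ ⟨hz, x, rfl⟩
    exact ⟨x, by simpa using hz, rfl⟩

/-- The range is compact and contains the dense set of principal ultrafilters. This later supplies
points of `λ X` with prescribed ultrafilters. -/
theorem extend_surjective (hp : IsLindelofPartition p) : Function.Surjective hp.extend := by
  rw [← range_eq_univ, ← univ_subset_iff, ← (denseRange_pure (α := I)).closure_range]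
  refine closure_minimal ?_ (isCompact_range hp.continuous_extend).isClosed
  rintro _ ⟨i, rfl⟩
  obtain ⟨x, rfl⟩ := hp.surjective i
  exact ⟨stoneCechUnit x, hp.extend_unit x⟩

variable (𝕜 : Type) [RCLike 𝕜]

/-- A cozero-set with Lindelöf closure lies over a countable `J`, and so does its closure in `βX`.
Conversely, the indicator function of `p ⁻¹' J` is continuous, and the closure in `βX` of its
cozero-set is already open. -/
theorem lambdaLindelof_eq (hp : IsLindelofPartition p) :
    lambdaLindelof 𝕜 X = {y | ∃ J : Set I, J.Countable ∧ J ∈ hp.extend y} := by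
  ext y
  simp only [lambdaLindelof, mem_iUnion, mem_ofPred_eq, exists_prop]
  constructor
  · rintro ⟨f, hf, hy⟩
    obtain ⟨J, hJ, hfJ⟩ := hp.exists_countable_of_lindelof hf
    refine ⟨J, hJ, ?_⟩
    have := closure_mono (image_mono hfJ) (interior_subset hy)
    rwa [hp.closure_image_preimage] at this
  · rintro ⟨J, hJ, hy⟩
    classical
    let f : X →ᵇ 𝕜 := BoundedContinuousFunction.ofNormedAddCommGroup
      (fun x => if p x ∈ J then 1 else 0) (hp.continuous_comp fun i => if i ∈ J then 1 else 0) 1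
      (fun x => by split_ifs <;> simp)
    have hf : Function.support f = p ⁻¹' J := by
      ext x
      simp [f]
    refine ⟨f, ?_, ?_⟩
    · rw [hf, (hp.isClopen_preimage J).1.closure_eq]
      exact hp.isLindelof_preimage hJ
    · rw [hf, hp.closure_image_preimage, (hp.isClopen_extend J).2.interior_eq]
      exact hy

theorem unit_mem_lambdaLindelof (hp : IsLindelofPartition p) (x : X) :
    stoneCechUnit x ∈ lambdaLindelof 𝕜 X := by
  rw [hp.lambdaLindelof_eq 𝕜]
  exact ⟨{p x}, countable_singleton _, by simp⟩

theorem isCompact_of_countable (hp : IsLindelofPartition p) {J : Set I} (hJ : J.Countable) :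
    IsCompact {y : lambdaLindelof 𝕜 X | J ∈ hp.extend y} := by
  rw [Subtype.isCompact_iff]
  convert (hp.isClopen_extend J).1.isCompact using 1
  ext y
  simp only [mem_image, mem_ofPred_eq, Subtype.exists, exists_and_left, exists_prop,
    exists_eq_right_right, and_iff_left_iff_imp]
  intro hy
  rw [hp.lambdaLindelof_eq 𝕜]
  exact ⟨J, hJ, hy⟩

theorem isClopen_extend' (hp : IsLindelofPartition p) (J : Set I) :
    IsClopen {y : lambdaLindelof 𝕜 X | J ∈ hp.extend y} :=
  (hp.isClopen_extend J).preimage continuous_subtype_val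

theorem exists_countable_mem (hp : IsLindelofPartition p) (y : lambdaLindelof 𝕜 X) :
    ∃ J : Set I, J.Countable ∧ J ∈ hp.extend y :=
  (hp.lambdaLindelof_eq 𝕜).subset y.2

/-- A compact subset of `λ X` lies in the closure of countably many pieces. -/
theorem exists_countable_of_isCompact (hp : IsLindelofPartition p)
    {K : Set (lambdaLindelof 𝕜 X)} (hK : IsCompact K) :
    ∃ J : Set I, J.Countable ∧ K ⊆ {y : lambdaLindelof 𝕜 X | J ∈ hp.extend y} := by
  choose J hJ hJm using hp.exists_countable_mem 𝕜
  obtain ⟨t, -, ht⟩ := hK.elim_nhds_subcover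
    (fun y => {z : lambdaLindelof 𝕜 X | J y ∈ hp.extend z})
    fun y _ => (hp.isClopen_extend' 𝕜 (J y)).2.mem_nhds (hJm y)
  refine ⟨⋃ y ∈ t, J y, t.countable_toSet.biUnion fun y _ => hJ y, fun z hz => ?_⟩
  obtain ⟨y, hy, hzy⟩ := mem_iUnion₂.1 (ht hz)
  exact Filter.mem_of_superset hzy (subset_biUnion_of_mem (u := J) hy)

theorem exists_countable_of_isSigmaCompact (hp : IsLindelofPartition p)
    {K : ℕ → Set (lambdaLindelof 𝕜 X)}
    (hK : ∀ n, IsCompact (K n)) :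
    ∃ J : Set I, J.Countable ∧ ⋃ n, K n ⊆ {y : lambdaLindelof 𝕜 X | J ∈ hp.extend y} := by
  choose J hJ hJm using fun n => hp.exists_countable_of_isCompact 𝕜 (hK n)
  exact ⟨⋃ n, J n, countable_iUnion hJ, iUnion_subset fun n y hy =>
    Filter.mem_of_superset (hJm n hy) (subset_iUnion J n)⟩

/-- The terms of a sequence all lie over one countable set of pieces, hence in one compact set. -/
theorem countablyCompactSpace_lambdaLindelof (hp : IsLindelofPartition p) :
    CountablyCompactSpace (lambdaLindelof 𝕜 X) := by
  refine ⟨isCountablyCompact_iff_seq_clusterPt.2 fun y _ => ?_⟩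
  obtain ⟨J, hJ, hyJ⟩ := hp.exists_countable_of_isSigmaCompact 𝕜 (K := fun n => {y n})
    fun n => isCompact_singleton
  obtain ⟨a, -, ha⟩ := (hp.isCompact_of_countable 𝕜 hJ).isCountablyCompact.seq_clusterPt y
    (.of_forall fun n => hyJ (mem_iUnion.2 ⟨n, rfl⟩))
  exact ⟨a, mem_univ a, ha⟩

end IsLindelofPartition

end Partition

/-! ### The algebra `C_𝒫(X)` and its identification with `C_c(λ X)`. -/

section Algebra

theorem support_eq_iUnion {𝕜 Z : Type*} [NormedAddGroup 𝕜] (f : Z → 𝕜) :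
    Function.support f = ⋃ n : ℕ, {x | 1 / ((n : ℝ) + 1) ≤ ‖f x‖} := by
  ext x
  simp only [Function.mem_support, mem_iUnion, mem_ofPred_eq]
  constructor
  · intro hx
    obtain ⟨n, hn⟩ := exists_nat_one_div_lt (norm_pos_iff.2 hx)
    exact ⟨n, hn.le⟩
  · rintro ⟨n, hn⟩
    exact norm_pos_iff.1 (Nat.one_div_pos_of_nat.trans_le hn)

variable {X : Type u} [TopologicalSpace X] {I : Type u} {p : X → I}
variable (𝕜 : Type) [RCLike 𝕜]

theorem compactSupported_subset_vanishingAtInfinity :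
    (compactSupported 𝕜 X : Set (X →ᵇ 𝕜)) ⊆ vanishingAtInfinity 𝕜 X := by
  intro f hf ε hε
  refine IsCompact.of_isClosed_subset hf (isClosed_le continuous_const f.continuous.norm) ?_
  intro x hx
  refine subset_tsupport _ ?_
  rw [Function.mem_support, ← norm_pos_iff]
  exact hε.trans_le hx

namespace IsLindelofPartition

variable {𝕜}

theorem mem_lindelofSupported_iff_countable (hp : IsLindelofPartition p) {f : X →ᵇ 𝕜} :
    f ∈ lindelofSupported 𝕜 X ↔ (p '' Function.support f).Countable := by
  rw [← hp.isLindelof_closure_iff]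
  constructor
  · rintro ⟨U, hU, hUL⟩
    exact hUL.of_isClosed_subset isClosed_closure (subset_of_mem_nhdsSet hU)
  · intro h
    refine ⟨p ⁻¹' (p '' tsupport f), ?_, hp.isLindelof_preimage (hp.countable_image h)⟩
    exact (hp.isOpen_preimage _).mem_nhdsSet.2 (subset_preimage_image p _)

theorem mem_lindelofSupported_iff (hp : IsLindelofPartition p) {f : X →ᵇ 𝕜} :
    f ∈ lindelofSupported 𝕜 X ↔ ∃ J : Set I, J.Countable ∧ ∀ x, p x ∉ J → f x = 0 := by
  rw [hp.mem_lindelofSupported_iff_countable]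
  constructor
  · refine fun h => ⟨_, h, fun x hx => ?_⟩
    by_contra hfx
    exact hx ⟨x, hfx, rfl⟩
  · rintro ⟨J, hJ, h⟩
    refine hJ.mono ?_
    rintro _ ⟨x, hx, rfl⟩
    by_contra hxJ
    exact hx (h x hxJ)

variable (𝕜)

theorem lindelofSupported_eq (hp : IsLindelofPartition p) :
    (lindelofSupported 𝕜 X : Set (X →ᵇ 𝕜)) = {f : X →ᵇ 𝕜 | IsLindelof (tsupport f)} := by
  ext f
  exact hp.mem_lindelofSupported_iff_countable.trans hp.isLindelof_closure_iff.symm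

theorem vanishingAtInfinity_subset (hp : IsLindelofPartition p) :
    vanishingAtInfinity 𝕜 X ⊆ (lindelofSupported 𝕜 X : Set (X →ᵇ 𝕜)) := by
  intro f hf
  refine hp.mem_lindelofSupported_iff_countable.2 ?_
  rw [support_eq_iUnion, image_iUnion]
  exact countable_iUnion fun n =>
    hp.countable_image (hf _ Nat.one_div_pos_of_nat).isLindelof

theorem uncountable (hp : IsLindelofPartition p) (hX : ¬ LindelofSpace X) : Uncountable I := by
  rw [← not_countable_iff]
  intro h
  refine hX (isLindelof_univ_iff.1 ?_)
  simpa using hp.isLindelof_preimage (countable_univ (α := I))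

/-- The bounded continuous function induced by a bounded function on the set of pieces. -/
noncomputable def ofPieces (hp : IsLindelofPartition p) (g : I → 𝕜) (C : ℝ)
    (hg : ∀ i, ‖g i‖ ≤ C) : X →ᵇ 𝕜 :=
  BoundedContinuousFunction.ofNormedAddCommGroup (fun x => g (p x)) (hp.continuous_comp g) C
    fun x => hg (p x)

/-- The indicator function of a countably infinite union of pieces has Lindelöf support, but its
level set at 1 is covered by infinitely many disjoint nonempty open pieces and is not compact. -/
theorem vanishingAtInfinity_ssubset (hp : IsLindelofPartition p) (hX : ¬ LindelofSpace X) :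
    vanishingAtInfinity 𝕜 X ⊂ (lindelofSupported 𝕜 X : Set (X →ᵇ 𝕜)) := by
  classical
  refine ⟨hp.vanishingAtInfinity_subset 𝕜, fun h => ?_⟩
  have := hp.uncountable hX
  let e := Infinite.natEmbedding I
  let f : X →ᵇ 𝕜 := hp.ofPieces 𝕜 (fun i => if i ∈ range e then 1 else 0) 1
    (fun i => by split_ifs <;> simp)
  have hf : f ∈ (lindelofSupported 𝕜 X : Set (X →ᵇ 𝕜)) :=
    hp.mem_lindelofSupported_iff.2 ⟨range e, countable_range e, fun x hx => if_neg hx⟩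
  have hfc := h hf 1 one_pos
  have hfs : {x | 1 ≤ ‖f x‖} = p ⁻¹' range e := by
    ext x
    by_cases hx : p x ∈ range e
    · have : f x = 1 := if_pos hx
      simp only [mem_ofPred_eq, this, mem_preimage, hx, iff_true]
      simp
    · have : f x = 0 := if_neg hx
      simp only [mem_ofPred_eq, this, mem_preimage, hx, iff_false]
      simp
  rw [hfs] at hfc
  obtain ⟨t, ht⟩ := hfc.elim_finite_subcover (fun i : I => p ⁻¹' {i})
    (fun i => hp.isOpen_preimage _) fun x _ => mem_iUnion.2 ⟨p x, rfl⟩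
  refine infinite_range_of_injective e.injective (t.finite_toSet.subset fun i hi => ?_)
  obtain ⟨x, rfl⟩ := hp.surjective i
  obtain ⟨j, hj, hx⟩ := mem_iUnion₂.1 (ht hi)
  rw [show p x = j from hx]
  exact hj

theorem completeSpace_lindelofSupported (hp : IsLindelofPartition p) :
    CompleteSpace (lindelofSupported 𝕜 X) := by
  suffices h : IsClosed (lindelofSupported 𝕜 X : Set (X →ᵇ 𝕜)) from h.completeSpace_coe
  refine IsSeqClosed.isClosed fun f g hf hfg => ?_
  choose J hJ hfJ using fun n => hp.mem_lindelofSupported_iff.1 (hf n)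
  refine hp.mem_lindelofSupported_iff.2 ⟨⋃ n, J n, countable_iUnion hJ, fun x hx => ?_⟩
  have h1 : Filter.Tendsto (fun n => f n x) Filter.atTop (𝓝 (g x)) :=
    ((continuous_eval_const x).tendsto g).comp hfg
  have h2 : ∀ n, f n x = 0 := fun n => hfJ n x fun h => hx (mem_iUnion.2 ⟨n, h⟩)
  simp only [h2] at h1
  exact (tendsto_nhds_unique h1 tendsto_const_nhds)

/-- The cozero-set of a function vanishing at infinity is σ-compact, so it lies over a countable
`J`, and the points over `J` form a closed compact set. -/
theorem compactSupported_lambdaLindelof_eq (hp : IsLindelofPartition p) :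
    (compactSupported 𝕜 (lambdaLindelof 𝕜 X) : Set (lambdaLindelof 𝕜 X →ᵇ 𝕜)) =
      vanishingAtInfinity 𝕜 (lambdaLindelof 𝕜 X) := by
  refine Subset.antisymm (compactSupported_subset_vanishingAtInfinity 𝕜) fun f hf => ?_
  obtain ⟨J, hJ, hfJ⟩ := hp.exists_countable_of_isSigmaCompact 𝕜
    fun n : ℕ => hf _ (Nat.one_div_pos_of_nat (n := n))
  rw [← support_eq_iUnion] at hfJ
  exact (hp.isCompact_of_countable 𝕜 hJ).of_isClosed_subset isClosed_closure
    (closure_minimal hfJ (hp.isClopen_extend' 𝕜 J).1)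

/-- The canonical map of a space into `λ X`. -/
noncomputable def toLambda (hp : IsLindelofPartition p) : C(X, lambdaLindelof 𝕜 X) :=
  ⟨fun x => ⟨stoneCechUnit x, hp.unit_mem_lambdaLindelof 𝕜 x⟩,
    continuous_stoneCechUnit.subtype_mk _⟩

theorem denseRange_toLambda (hp : IsLindelofPartition p) : DenseRange (hp.toLambda 𝕜) := by
  have := (denseRange_stoneCechUnit (α := X)).preimage
    (isOpen_lambdaLindelof (X := X) 𝕜).isOpenEmbedding_subtypeVal.isOpenMap
  refine this.mono ?_
  rintro ⟨y, hy⟩ ⟨x, hx⟩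
  exact ⟨x, Subtype.ext hx⟩

theorem compContinuous_mem (hp : IsLindelofPartition p) {f : lambdaLindelof 𝕜 X →ᵇ 𝕜}
    (hf : f ∈ compactSupported 𝕜 (lambdaLindelof 𝕜 X)) :
    f.compContinuous (hp.toLambda 𝕜) ∈ lindelofSupported 𝕜 X := by
  obtain ⟨J, hJ, hfJ⟩ := hp.exists_countable_of_isCompact 𝕜 hf
  refine hp.mem_lindelofSupported_iff.2 ⟨J, hJ, fun x hx => ?_⟩
  by_contra h
  have h1 : J ∈ hp.extend (hp.toLambda 𝕜 x) := hfJ (subset_tsupport _ h)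
  have h2 : hp.extend (hp.toLambda 𝕜 x) = pure (p x) := hp.extend_unit x
  rw [h2] at h1
  exact hx h1

/-- Restriction of functions from `λ X` to `X`. -/
noncomputable def restrictHom (hp : IsLindelofPartition p) :
    compactSupported 𝕜 (lambdaLindelof 𝕜 X) →ₙₐ[𝕜] lindelofSupported 𝕜 X where
  toFun f := ⟨f.1.compContinuous (hp.toLambda 𝕜), hp.compContinuous_mem 𝕜 f.2⟩
  map_smul' _ _ := rfl
  map_zero' := rfl
  map_add' _ _ := rfl
  map_mul' _ _ := rfl

theorem norm_restrictHom (hp : IsLindelofPartition p)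
    (f : compactSupported 𝕜 (lambdaLindelof 𝕜 X)) : ‖hp.restrictHom 𝕜 f‖ = ‖f‖ := by
  apply le_antisymm
  · exact (BoundedContinuousFunction.norm_le (norm_nonneg _)).2 fun x =>
      f.1.norm_coe_le_norm _
  · refine (BoundedContinuousFunction.norm_le (norm_nonneg _)).2 fun y => ?_
    refine (hp.denseRange_toLambda 𝕜).induction_on y
      (isClosed_le f.1.continuous.norm continuous_const) fun x => ?_
    exact (hp.restrictHom 𝕜 f).1.norm_coe_le_norm x

theorem restrictHom_surjective (hp : IsLindelofPartition p) :
    Function.Surjective (hp.restrictHom 𝕜) := by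
  rintro ⟨f, hf⟩
  obtain ⟨J, hJ, hfJ⟩ := hp.mem_lindelofSupported_iff.1 hf
  -- A bounded function takes values in a compact ball, so it extends to `βX`; `ULift` puts the ball
  -- in the universe of `X`.
  let f' : X → ULift.{u} (Metric.closedBall (0 : 𝕜) ‖f‖) := fun x =>
    ⟨⟨f x, mem_closedBall_zero_iff.2 (f.norm_coe_le_norm x)⟩⟩
  have hf' : Continuous f' := continuous_uliftUp.comp (f.continuous.subtype_mk _)
  have : CompactSpace (Metric.closedBall (0 : 𝕜) ‖f‖) :=
    isCompact_iff_compactSpace.1 (isCompact_closedBall _ _)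
  let g : lambdaLindelof 𝕜 X →ᵇ 𝕜 := BoundedContinuousFunction.ofNormedAddCommGroup
    (fun y => ((stoneCechExtend hf' y).down : 𝕜))
    (continuous_subtype_val.comp (continuous_uliftDown.comp
      ((continuous_stoneCechExtend hf').comp continuous_subtype_val))) ‖f‖
    fun y => mem_closedBall_zero_iff.1 (stoneCechExtend hf' y).down.2
  have hgf : ∀ x, g (hp.toLambda 𝕜 x) = f x := fun x =>
    congrArg (fun z => (z.down : 𝕜)) (stoneCechExtend_stoneCechUnit hf' x)
  have hg : g ∈ compactSupported 𝕜 (lambdaLindelof 𝕜 X) := by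
    refine (hp.isCompact_of_countable 𝕜 hJ).of_isClosed_subset isClosed_closure
      (closure_minimal (fun y hy => ?_) (hp.isClopen_extend' 𝕜 J).1)
    by_contra hyJ
    refine hy ?_
    -- Points of `X` are dense in the open complement, and there the extension agrees with `f`,
    -- which vanishes off `J`.
    have hO := (hp.isClopen_extend' 𝕜 J).1.isOpen_compl
    have : y ∈ closure ({y : lambdaLindelof 𝕜 X | J ∈ hp.extend y}ᶜ ∩ range (hp.toLambda 𝕜)) :=
      hO.inter_closure ⟨hyJ, hp.denseRange_toLambda 𝕜 y⟩
    refine closure_minimal ?_ (isClosed_eq g.continuous continuous_const) this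
    rintro _ ⟨hx, x, rfl⟩
    rw [mem_ofPred_eq, hgf]
    refine hfJ x fun hxJ => hx ?_
    have h2 : hp.extend (hp.toLambda 𝕜 x) = pure (p x) := hp.extend_unit x
    rw [mem_ofPred_eq, h2]
    exact hxJ
  refine ⟨⟨g, hg⟩, Subtype.ext (BoundedContinuousFunction.ext hgf)⟩

theorem restrictHom_injective (hp : IsLindelofPartition p) :
    Function.Injective (hp.restrictHom 𝕜) :=
  (AddMonoidHomClass.isometry_of_norm (hp.restrictHom 𝕜) (hp.norm_restrictHom 𝕜)).injective

theorem isometricallyIsomorphic (hp : IsLindelofPartition p) :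
    IsometricallyIsomorphic 𝕜 (lindelofSupported 𝕜 X)
      (compactSupported 𝕜 (lambdaLindelof 𝕜 X)) := by
  obtain ⟨g, h1, h2⟩ := Function.bijective_iff_has_inverse.1
    ⟨hp.restrictHom_injective 𝕜, hp.restrictHom_surjective 𝕜⟩
  refine ⟨(hp.restrictHom 𝕜).inverse g h1 h2, ⟨h2.injective, h1.surjective⟩, fun a => ?_⟩
  rw [← hp.norm_restrictHom 𝕜]
  exact congrArg norm (h2 a)

end IsLindelofPartition

end Algebra

/-! ### Characters of `C_c(T)` and the Banach–Stone theorem. -/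

section Characters

variable (𝕜 : Type) [RCLike 𝕜] {T : Type*} [TopologicalSpace T]

/-- Evaluation at a point as a homomorphism on the continuous functions with compact support. -/
def compactSupportedEval (t : T) : compactSupported 𝕜 T →ₙₐ[𝕜] 𝕜 where
  toFun f := f.1 t
  map_smul' _ _ := rfl
  map_zero' := rfl
  map_add' _ _ := rfl
  map_mul' _ _ := rfl

@[simp]
theorem compactSupportedEval_apply (t : T) (f : compactSupported 𝕜 T) :
    compactSupportedEval 𝕜 t f = f.1 t := rfl

theorem exists_compactSupported_eq_one [T2Space T] [LocallyCompactSpace T] {t : T} {U : Set T}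
    (hU : IsOpen U) (ht : t ∈ U) :
    ∃ f : compactSupported 𝕜 T, f.1 t = 1 ∧ ∀ x, x ∉ U → f.1 x = 0 := by
  obtain ⟨f, hf1, hf0, hfc, -⟩ := exists_continuous_one_zero_of_isCompact
    (isCompact_singleton (x := t)) hU.isClosed_compl
    (disjoint_compl_right_iff_subset.2 (singleton_subset_iff.2 ht))
  have hgc : HasCompactSupport fun x => (f x : 𝕜) :=
    hfc.comp_left (g := ((↑) : ℝ → 𝕜)) RCLike.ofReal_zero
  refine ⟨⟨BoundedContinuousFunction.ofNormedAddCommGroup (fun x => (f x : 𝕜))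
    (RCLike.continuous_ofReal.comp f.continuous) _
    (hgc.exists_bound_of_continuous (RCLike.continuous_ofReal.comp f.continuous)).choose_spec,
    hgc⟩, ?_, fun x hx => ?_⟩
  · change ((f t : ℝ) : 𝕜) = 1
    rw [hf1 rfl]
    simp
  · change ((f x : ℝ) : 𝕜) = 0
    rw [hf0 hx]
    simp

variable {𝕜}

/-- The complex conjugate of a continuous function with compact support. -/
noncomputable def compactSupportedStar (f : compactSupported 𝕜 T) : compactSupported 𝕜 T :=
  ⟨star f.1, by
    change IsCompact (tsupport fun x => star (f.1 x))
    exact HasCompactSupport.comp_left (f := ⇑f.1) f.2 (star_zero 𝕜)⟩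

/-- If `g` does not vanish on the support of `e`, then `g` divides `e`. -/
theorem exists_mul_eq_of_ne_zero {e g : compactSupported 𝕜 T}
    (h : ∀ x ∈ tsupport e.1, g.1 x ≠ 0) : ∃ q, g * q = e := by
  have hc : Continuous fun x => e.1 x / g.1 x := by
    refine continuous_iff_continuousAt.2 fun x => ?_
    by_cases hx : x ∈ tsupport e.1
    · exact e.1.continuous.continuousAt.div g.1.continuous.continuousAt (h x hx)
    · have : (fun x => e.1 x / g.1 x) =ᶠ[𝓝 x] fun _ => 0 := by
        filter_upwards [notMem_tsupport_iff_eventuallyEq.1 hx] with y hy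
        rw [hy]
        simp
      exact this.continuousAt
  have hs : HasCompactSupport fun x => e.1 x / g.1 x := by
    refine HasCompactSupport.mono (f := ⇑e.1) e.2 fun x hx he => hx ?_
    simp only [he, zero_div]
  refine ⟨⟨BoundedContinuousFunction.ofNormedAddCommGroup _ hc _
    (hs.exists_bound_of_continuous hc).choose_spec, hs⟩, ?_⟩
  refine Subtype.ext (BoundedContinuousFunction.ext fun x => ?_)
  change g.1 x * (e.1 x / g.1 x) = e.1 x
  by_cases hx : x ∈ tsupport e.1
  · exact mul_div_cancel₀ _ (h x hx)
  · rw [image_eq_zero_of_notMem_tsupport hx]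
    simp

/-- Every nonzero character of the algebra of continuous functions with compact support is the
evaluation at a point. -/
theorem exists_eq_compactSupportedEval [T2Space T] [LocallyCompactSpace T]
    (χ : compactSupported 𝕜 T →ₙₐ[𝕜] 𝕜) {e : compactSupported 𝕜 T} (he : χ e ≠ 0) :
    ∃ t : T, ∀ f, χ f = f.1 t := by
  by_contra! hχ
  -- If the kernel of `χ` vanished at `t`, it would contain `χ e • f - χ f • e`, making `χ` and
  -- evaluation at `t` proportional; comparing them on `e * e` forces the ratio to be 1.
  have key : ∀ t : T, ∃ g : compactSupported 𝕜 T, χ g = 0 ∧ g.1 t ≠ 0 := by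
    intro t
    by_contra! h
    obtain ⟨f, hf⟩ := hχ t
    have hev : ∀ f : compactSupported 𝕜 T, f.1 t * χ e = χ f * e.1 t := by
      intro f
      have := h (χ e • f - χ f • e) (by simp [mul_comm])
      have h2 : χ e * f.1 t - χ f * e.1 t = 0 := this
      linear_combination h2
    have h0 : e.1 t ≠ 0 := by
      intro h0
      obtain ⟨b, hb, -⟩ := exists_compactSupported_eq_one 𝕜 isOpen_univ (mem_univ t)
      have := hev b
      rw [hb, h0] at this
      simp [he] at this
    have h1 := hev (e * e)
    have h2 : (e * e).1 t = e.1 t * e.1 t := rfl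
    rw [map_mul, h2] at h1
    have h3 : e.1 t = χ e := by
      have : e.1 t * χ e * (e.1 t - χ e) = 0 := by linear_combination h1
      rcases mul_eq_zero.1 this with h | h
      · exact absurd h (mul_ne_zero h0 he)
      · exact sub_eq_zero.1 h
    have h4 := hev f
    rw [h3] at h4
    exact hf (mul_right_cancel₀ he h4).symm
  choose G hG0 hGt using key
  obtain ⟨s, -, hs⟩ := IsCompact.elim_nhds_subcover (s := tsupport e.1) e.2
    (fun t => {x | (G t).1 x ≠ 0})
    fun t _ => (isOpen_ne_fun (G t).1.continuous continuous_const).mem_nhds (hGt t)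
  -- This sum of the `|G t|²` lies in the kernel of `χ` and is positive on the support of `e`, so it
  -- divides `e`, contradicting `χ e ≠ 0`.
  let g := ∑ t ∈ s, G t * compactSupportedStar (G t)
  have hg0 : χ g = 0 := by
    simp only [g, map_sum, map_mul, hG0, zero_mul, Finset.sum_const_zero]
  have hgx : ∀ x, g.1 x = ((∑ t ∈ s, ‖(G t).1 x‖ ^ 2 : ℝ) : 𝕜) := by
    intro x
    have : compactSupportedEval 𝕜 x g = _ := map_sum (compactSupportedEval 𝕜 x) _ s
    rw [compactSupportedEval_apply] at this
    rw [this]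
    push_cast
    refine Finset.sum_congr rfl fun t _ => ?_
    exact RCLike.mul_conj _
  obtain ⟨q, hq⟩ := exists_mul_eq_of_ne_zero (e := e) (g := g) fun x hx => by
    obtain ⟨t, hts, ht⟩ := mem_iUnion₂.1 (hs hx)
    rw [hgx]
    refine RCLike.ofReal_ne_zero.2 (ne_of_gt ?_)
    exact Finset.sum_pos' (fun _ _ => by positivity) ⟨t, hts, by
      have := norm_pos_iff.2 ht
      positivity⟩
  rw [← hq, map_mul, hg0, zero_mul] at he
  exact he rfl

theorem eq_of_forall_compactSupported [T2Space T] [LocallyCompactSpace T] {s t : T}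
    (h : ∀ f : compactSupported 𝕜 T, f.1 s = f.1 t) : s = t := by
  by_contra hst
  obtain ⟨f, hf, hf0⟩ := exists_compactSupported_eq_one 𝕜 (isOpen_compl_singleton (x := t)) hst
  have := h f
  rw [hf, hf0 t (by simp)] at this
  exact one_ne_zero this

/-- The sets where some compactly supported function is nonzero form a base of `T`. -/
theorem continuous_of_compactSupported {S : Type*} [TopologicalSpace S] [T2Space T]
    [LocallyCompactSpace T] {θ : S → T}
    (h : ∀ f : compactSupported 𝕜 T, Continuous fun s => f.1 (θ s)) : Continuous θ := by
  refine continuous_iff_continuousAt.2 fun s => ?_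
  intro V hV
  obtain ⟨U, hUV, hU, hs⟩ := mem_nhds_iff.1 hV
  obtain ⟨f, hf, hf0⟩ := exists_compactSupported_eq_one 𝕜 hU hs
  have : {r | f.1 (θ r) ≠ 0} ∈ 𝓝 s :=
    (isOpen_ne_fun (h f) continuous_const).mem_nhds (by simp [hf])
  refine Filter.mem_map.2 (Filter.mem_of_superset this fun r hr => hUV ?_)
  by_contra hrU
  exact hr (hf0 _ hrU)

variable {S : Type*} [TopologicalSpace S] [T2Space S] [LocallyCompactSpace S]
  [T2Space T] [LocallyCompactSpace T]

/-- Evaluation at `t` composed with `ψ` is a character, nonzero because `ψ` is surjective, hence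
evaluation at a point `θ t`. -/
theorem exists_map_of_surjective (ψ : compactSupported 𝕜 S →ₙₐ[𝕜] compactSupported 𝕜 T)
    (hψ : Function.Surjective ψ) : ∃ θ : T → S, ∀ f t, (ψ f).1 t = f.1 (θ t) := by
  have : ∀ t : T, ∃ s : S, ∀ f, (ψ f).1 t = f.1 s := by
    intro t
    obtain ⟨b, hb, -⟩ := exists_compactSupported_eq_one 𝕜 isOpen_univ (mem_univ t)
    obtain ⟨e, rfl⟩ := hψ b
    exact exists_eq_compactSupportedEval ((compactSupportedEval 𝕜 t).comp ψ) (e := e) (by simp [hb])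
  choose θ hθ using this
  exact ⟨θ, fun f t => hθ t f⟩

/-- A Banach–Stone theorem for continuous functions with compact support. -/
theorem nonempty_homeomorph_of_bijective
    (ψ : compactSupported 𝕜 S →ₙₐ[𝕜] compactSupported 𝕜 T) (hψ : Function.Bijective ψ) :
    Nonempty (T ≃ₜ S) := by
  obtain ⟨g, h1, h2⟩ := Function.bijective_iff_has_inverse.1 hψ
  obtain ⟨θ, hθ⟩ := exists_map_of_surjective ψ hψ.2
  obtain ⟨η, hη⟩ := exists_map_of_surjective (ψ.inverse g h1 h2) h1.surjective
  have hη' : ∀ f s, (g f).1 s = f.1 (η s) := hη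
  refine ⟨⟨⟨θ, η, fun t => ?_, fun s => ?_⟩, ?_, ?_⟩⟩
  · refine eq_of_forall_compactSupported (𝕜 := 𝕜) fun f => ?_
    rw [← hη', ← hθ, h2]
  · refine eq_of_forall_compactSupported (𝕜 := 𝕜) fun f => ?_
    rw [← hθ, ← hη', h1]
  · refine continuous_of_compactSupported (𝕜 := 𝕜) fun f => ?_
    simpa only [← hθ] using (ψ f).1.continuous
  · refine continuous_of_compactSupported (𝕜 := 𝕜) fun f => ?_
    simpa only [← hη'] using (g f).1.continuous

end Characters

/-! ### Failure of normality. -/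

section NotNormal

/-- The Fichtenholz–Kantorovich–Hausdorff independent family: `(n, c)` belongs to `S η` when the
trace of `h η` on `{0, …, n - 1}` is one of the sets listed in `c`. -/
theorem exists_isIndependent_family {Ω : Type*} {h : Ω → Set ℕ} (hh : Function.Injective h) :
    ∃ S : Ω → Set (ℕ × Finset (Finset ℕ)), ∀ T : Set Ω,
      ∃ W : Ultrafilter (ℕ × Finset (Finset ℕ)), ∀ η, S η ∈ W ↔ η ∈ T := by
  classical
  let t : ℕ → Ω → Finset ℕ := fun n η => (Finset.range n).filter (· ∈ h η)
  have ht : ∀ η ζ, ∀ᶠ n in Filter.atTop, t n η = t n ζ → η = ζ := by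
    intro η ζ
    by_cases hηζ : η = ζ
    · exact .of_forall fun _ _ => hηζ
    obtain ⟨k, hk⟩ : ∃ k, ¬ (k ∈ h η ↔ k ∈ h ζ) := by
      by_contra! H
      exact hηζ (hh (Set.ext H))
    filter_upwards [Filter.eventually_gt_atTop k] with n hn he
    have : k ∈ t n η ↔ k ∈ t n ζ := by rw [he]
    simp only [t, Finset.mem_filter, Finset.mem_range, hn, true_and] at this
    exact absurd this hk
  let S : Ω → Set (ℕ × Finset (Finset ℕ)) := fun η => {c | t c.1 η ∈ c.2}
  refine ⟨S, fun T => ?_⟩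
  let A : Ω → Set (ℕ × Finset (Finset ℕ)) := fun η => if η ∈ T then S η else (S η)ᶜ
  obtain ⟨W, hW⟩ := Ultrafilter.exists_ultrafilter_of_finite_inter_nonempty (range A) <| by
    intro R hR
    rw [← image_univ, Finset.subset_set_image_iff] at hR
    obtain ⟨F, -, rfl⟩ := hR
    -- Choose `n` so large that the finitely many indices in `F` have distinct traces, then list the
    -- traces of those in `T`.
    obtain ⟨n, hn⟩ := ((Filter.eventually_all_finset F).2 fun η _ =>
      (Filter.eventually_all_finset F).2 fun ζ _ => ht η ζ).exists
    refine ⟨(n, (F.filter (· ∈ T)).image (t n)), ?_⟩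
    simp only [Finset.coe_image, sInter_image, mem_iInter, Finset.mem_coe]
    intro η hη
    by_cases hT : η ∈ T
    · simp only [A, if_pos hT]
      exact Finset.mem_image_of_mem _ (Finset.mem_filter.2 ⟨hη, hT⟩)
    · simp only [A, if_neg hT]
      intro hc
      obtain ⟨ζ, hζ, he⟩ := Finset.mem_image.1 hc
      obtain ⟨hζF, hζT⟩ := Finset.mem_filter.1 hζ
      exact hT (hn ζ hζF η hη he ▸ hζT)
  refine ⟨W, fun η => ?_⟩
  have hA : A η ∈ W := hW (mem_range_self η)
  by_cases hT : η ∈ T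
  · simp only [A, if_pos hT] at hA
    simp [hA, hT]
  · simp only [A, if_neg hT] at hA
    simp only [hT, iff_false]
    exact Ultrafilter.compl_mem_iff_notMem.1 hA

theorem MapClusterPt.mem_of_isClosed {Z ι : Type*} [TopologicalSpace Z] {a : Z} {l : Filter ι}
    {f : ι → Z} (h : MapClusterPt a l f) {F : Set Z} (hF : IsClosed F) (hf : ∀ᶠ i in l, f i ∈ F) :
    a ∈ F := by
  by_contra ha
  obtain ⟨i, hi, hi'⟩ := ((h.frequently (hF.isOpen_compl.mem_nhds ha)).and_eventually hf).exists
  exact hi hi'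

theorem exists_omega_one_type : ∃ (Ω : Type) (_ : LinearOrder Ω) (_ : WellFoundedLT Ω),
    #Ω = ℵ₁ ∧ ∀ s : Set Ω, s.Countable → ∃ b, ∀ a ∈ s, a < b := by
  refine ⟨(ℵ₁ : Cardinal.{0}).ord.ToType, inferInstance, inferInstance, Cardinal.mk_ord_toType _,
    fun s hs => ?_⟩
  by_contra! H
  have hc : (⋃ a ∈ s, Iic a).Countable := hs.biUnion fun a _ => by
    have h := Cardinal.mk_Iio_lt a (by simp)
    rw [Cardinal.mk_ord_toType, ← not_le, Cardinal.aleph_one_le_iff, not_lt,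
      Cardinal.le_aleph0_iff_set_countable] at h
    rw [← Iio_insert]
    exact h.insert a
  have hu : (⋃ a ∈ s, Iic a) = univ := eq_univ_of_forall fun b => by
    obtain ⟨a, ha, hab⟩ := H b
    exact mem_iUnion₂.2 ⟨a, ha, hab⟩
  rw [hu, ← Cardinal.le_aleph0_iff_set_countable, Cardinal.mk_univ, Cardinal.mk_ord_toType] at hc
  exact hc.not_gt Cardinal.aleph0_lt_aleph_one

namespace IsLindelofPartition

variable {X : Type u} [TopologicalSpace X] {I : Type u} {p : X → I}
variable (𝕜 : Type) [RCLike 𝕜]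

theorem exists_extend_eq (hp : IsLindelofPartition p) {J : Set I} (hJ : J.Countable)
    {w : Ultrafilter I} (hw : J ∈ w) : ∃ y : lambdaLindelof 𝕜 X, hp.extend y = w := by
  obtain ⟨y, rfl⟩ := hp.extend_surjective w
  exact ⟨⟨y, (hp.lambdaLindelof_eq 𝕜).superset ⟨J, hJ, hw⟩⟩, rfl⟩

/-- Record for each point of `λ X` the sets of `η` for which its ultrafilter contains `U η`,
respectively `V η`. Initial segments as values play the role of coordinates in `ω₁ × (ω₁ + 1)`: `w ξ
β` sits at `(ξ, β)`, `A` corresponds to the diagonal and `B` to the top edge. Independence of the `S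
η` is what provides every second coordinate `β` over a countable set of pieces. -/
theorem not_normalSpace_of_embedding (hp : IsLindelofPartition p) {Ω : Type*} [LinearOrder Ω]
    [WellFoundedLT Ω] (hΩ : ∀ s : Set Ω, s.Countable → ∃ b, ∀ a ∈ s, a < b)
    {h : Ω → Set ℕ} (hh : Function.Injective h)
    {e : Ω × (ℕ × Finset (Finset ℕ)) → I} (he : Function.Injective e) :
    ¬ NormalSpace (lambdaLindelof 𝕜 X) := by
  intro hN
  obtain ⟨ξ₀, -⟩ := hΩ ∅ countable_empty
  have : Nonempty Ω := ⟨ξ₀⟩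
  have : NoMaxOrder Ω := ⟨fun a => by
    obtain ⟨b, hb⟩ := hΩ {a} (countable_singleton a)
    exact ⟨b, hb a rfl⟩⟩
  obtain ⟨S, hS⟩ := exists_isIndependent_family hh
  choose W hW using hS
  obtain ⟨q, hq⟩ := he.hasLeftInverse
  let U : Ω → Set I := fun η => {i | η < (q i).1}
  let V : Ω → Set I := fun η => {i | (q i).2 ∈ S η}
  let w : Ω → Ω → Ultrafilter I := fun ξ β => (W (Iio β)).map fun c => e (ξ, c)
  have hwU : ∀ ξ β η, U η ∈ w ξ β ↔ η < ξ := by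
    intro ξ β η
    have : (fun c => e (ξ, c)) ⁻¹' U η = {_c | η < ξ} := by
      ext c
      simp [U, hq (ξ, c)]
    rw [Ultrafilter.mem_map, this]
    by_cases hηξ : η < ξ
    · simp only [hηξ, iff_true]
      exact Filter.univ_mem' fun _ => trivial
    · simp [hηξ]
  have hwV : ∀ ξ β η, V η ∈ w ξ β ↔ η < β := by
    intro ξ β η
    have : (fun c => e (ξ, c)) ⁻¹' V η = S η := by
      ext c
      simp [V, hq (ξ, c)]
    rw [Ultrafilter.mem_map, this, hW]
    rfl
  have hwR : ∀ ξ β, range (fun c => e (ξ, c)) ∈ w ξ β := fun ξ β =>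
    Filter.mem_map.2 (Filter.univ_mem' fun c => mem_range_self c)
  have hcl := hp.isClopen_extend' 𝕜
  let D : Ω → Set (lambdaLindelof 𝕜 X) := fun η => {y | U η ∈ hp.extend y ↔ V η ∈ hp.extend y}
  have hD : ∀ η, IsClosed (D η) := by
    intro η
    have : D η = ({y : lambdaLindelof 𝕜 X | U η ∈ hp.extend y} ∩ {y | V η ∈ hp.extend y}) ∪
        ({y : lambdaLindelof 𝕜 X | U η ∈ hp.extend y}ᶜ ∩ {y | V η ∈ hp.extend y}ᶜ) := by
      ext y
      exact iff_iff_and_or_not_and_not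
    rw [this]
    exact (((hcl _).inter (hcl _)).union ((hcl _).compl.inter (hcl _).compl)).1
  let A : Set (lambdaLindelof 𝕜 X) := ⋂ η, D η
  let B : Set (lambdaLindelof 𝕜 X) := ⋂ η, {y | V η ∈ hp.extend y}
  have hAB : Disjoint A B := by
    rw [disjoint_left]
    intro y hA hB
    obtain ⟨J, hJ, hyJ⟩ := hp.exists_countable_mem 𝕜 y
    -- First coordinates are bounded on a countable set of pieces, so no point of `λ X` has all the
    -- `U η`.
    obtain ⟨η, hη⟩ := hΩ ((fun i => (q i).1) '' J) (hJ.image _)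
    have h1 : U η ∈ hp.extend y := (mem_iInter.1 hA η).2 (mem_iInter.1 hB η)
    obtain ⟨i, hi, hiJ⟩ := (hp.extend y).nonempty_of_mem (Filter.inter_mem h1 hyJ)
    exact lt_asymm hi (hη _ ⟨i, hiJ, rfl⟩)
  obtain ⟨G, H, hG, hH, hAG, hBH, hGH⟩ := normal_separation (isClosed_iInter hD)
    (isClosed_iInter fun η => (hcl (V η)).1) hAB
  -- For fixed `ξ`, points over `w ξ β` stay in a compact set and cluster in `B` as `β` grows, so
  -- they cannot all avoid the neighborhood `H` of `B`.
  have step : ∀ ξ, ∃ β > ξ, ∃ y ∈ H, hp.extend y = w ξ β := by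
    intro ξ
    by_contra! hno
    choose y hy using fun β => hp.exists_extend_eq 𝕜
      (countable_range fun c => e (ξ, c)) (hwR ξ β)
    obtain ⟨a, -, ha⟩ := (hp.isCompact_of_countable 𝕜
      (countable_range fun c => e (ξ, c))).exists_mapClusterPt (f := Filter.atTop) (u := y)
      (Filter.tendsto_principal.2 (.of_forall fun β => by
        rw [mem_ofPred_eq, hy]
        exact hwR ξ β))
    have haB : a ∈ B := mem_iInter.2 fun η => ha.mem_of_isClosed (hcl _).1 <| by
      filter_upwards [Filter.eventually_gt_atTop η] with β hβ
      rw [hy, hwV]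
      exact hβ
    have haH : a ∈ Hᶜ := ha.mem_of_isClosed hH.isClosed_compl <| by
      filter_upwards [Filter.eventually_gt_atTop ξ] with β hβ hyH
      exact hno β hβ (y β) hyH (hy β)
    exact haH (hBH haB)
  choose β hβ y hyH hy using step
  let ξ : ℕ → Ω := fun n => β^[n] ξ₀
  have hξ : ∀ n, ξ (n + 1) = β (ξ n) := fun n => Function.iterate_succ_apply' β n ξ₀
  have hξm : StrictMono ξ := strictMono_nat_of_lt_succ fun n => by
    rw [hξ]
    exact hβ _
  obtain ⟨b, hb⟩ := hΩ (range ξ) (countable_range ξ)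
  let M : Set Ω := {b | ∀ n, ξ n ≤ b}
  have hM : M.Nonempty := ⟨b, fun n => (hb _ ⟨n, rfl⟩).le⟩
  -- The supremum of the `ξ n`. Both coordinates `ξ n` and `β (ξ n) = ξ (n + 1)` increase to `s`, so
  -- cluster points of the chosen points of `H` lie on the diagonal `A`.
  let s := WellFounded.min (wellFounded_lt (α := Ω)) M hM
  have hs : ∀ n, ξ n ≤ s := WellFounded.min_mem _ M hM
  have hs' : ∀ η < s, ∃ n, η < ξ n := by
    intro η hη
    by_contra! H
    exact WellFounded.not_lt_min wellFounded_lt M H hη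
  have := hp.countablyCompactSpace_lambdaLindelof 𝕜
  obtain ⟨a, -, ha⟩ := isCountablyCompact_iff_seq_clusterPt.1
    CountablyCompactSpace.isCountablyCompact_univ (fun n => y (ξ n)) (.of_forall fun n => mem_univ _)
  have haA : a ∈ A := mem_iInter.2 fun η => ha.mem_of_isClosed (hD η) <| by
    by_cases hη : η < s
    · obtain ⟨m, hm⟩ := hs' η hη
      filter_upwards [Filter.eventually_ge_atTop m] with n hn
      have h1 : η < ξ n := hm.trans_le (hξm.monotone hn)
      rw [mem_ofPred_eq, hy, hwU, hwV]
      exact iff_of_true h1 (h1.trans (hβ _))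
    · refine .of_forall fun n => ?_
      rw [mem_ofPred_eq, hy, hwU, hwV, ← hξ]
      exact iff_of_false (fun h => hη (h.trans_le (hs _))) (fun h => hη (h.trans_le (hs _)))
  obtain ⟨n, hn⟩ := (ha.frequently (hG.mem_nhds (hAG haA))).exists
  exact disjoint_left.1 hGH hn (hyH _)

theorem not_normalSpace (hp : IsLindelofPartition p) (hX : ¬ LindelofSpace X) :
    ¬ NormalSpace (lambdaLindelof 𝕜 X) := by
  have := hp.uncountable hX
  obtain ⟨Ω, _, _, hcard, hΩ⟩ := exists_omega_one_type
  obtain ⟨h⟩ : #Ω ≤ #(Set ℕ) := by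
    rw [hcard, Cardinal.mk_set, Cardinal.mk_nat, Cardinal.two_power_aleph0]
    exact Cardinal.aleph_one_le_continuum
  obtain ⟨e⟩ : Nonempty (Ω × (ℕ × Finset (Finset ℕ)) ↪ I) := by
    rw [← Cardinal.lift_mk_le', Cardinal.mk_prod, hcard]
    have h1 : #(ℕ × Finset (Finset ℕ)) ≤ ℵ₁ :=
      Cardinal.mk_le_aleph0.trans Cardinal.aleph0_lt_aleph_one.le
    have h2 : ℵ₁ ≤ #I := Cardinal.aleph_one_le_iff.2 Cardinal.aleph0_lt_mk
    have h3 : (ℵ₁ * #(ℕ × Finset (Finset ℕ)) : Cardinal.{0}) ≤ ℵ₁ :=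
      (mul_le_mul_right h1 _).trans (Cardinal.mul_eq_self (Cardinal.aleph0_le_aleph 1)).le
    simp only [Cardinal.lift_id]
    calc _ ≤ Cardinal.lift.{u} (ℵ₁ : Cardinal.{0}) := Cardinal.lift_le.2 h3
      _ = ℵ₁ := by simp
      _ ≤ #I := h2
      _ = _ := (Cardinal.lift_uzero _).symm
  exact hp.not_normalSpace_of_embedding 𝕜 hΩ h.injective e.injective

end IsLindelofPartition

end NotNormal

/-! ### The Lindelöf number and the dimension. -/

section Dimension

theorem IsLindelof.exists_countable_dense {X : Type*} [PseudoMetricSpace X] {S : Set X}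
    (hS : IsLindelof S) : ∃ D ⊆ S, D.Countable ∧ S ⊆ closure D := by
  have h (n : ℕ) : ∃ t : Set X, t.Countable ∧ (∀ x ∈ t, x ∈ S) ∧
      S ⊆ ⋃ x ∈ t, Metric.ball x (1 / ((n : ℝ) + 1)) :=
    hS.elim_nhds_subcover _ fun x _ => Metric.ball_mem_nhds x Nat.one_div_pos_of_nat
  choose t ht htS hSt using h
  refine ⟨⋃ n, t n, iUnion_subset htS, countable_iUnion ht, fun x hx => ?_⟩
  refine Metric.mem_closure_iff.2 fun ε hε => ?_
  obtain ⟨n, hn⟩ := exists_nat_one_div_lt hε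
  obtain ⟨y, hy, hxy⟩ := mem_iUnion₂.1 (hSt n hx)
  exact ⟨y, mem_iUnion.2 ⟨n, hy⟩, (Metric.mem_ball.1 hxy).trans hn⟩

theorem RCLike.mk_le_continuum (𝕜 : Type) [RCLike 𝕜] : #𝕜 ≤ 𝔠 := by
  have : Function.Injective fun z : 𝕜 => (RCLike.re z, RCLike.im z) := fun z w h =>
    RCLike.ext (congrArg Prod.fst h) (congrArg Prod.snd h)
  calc #𝕜 ≤ #(ℝ × ℝ) := Cardinal.mk_le_of_injective this
    _ = 𝔠 := by simp [Cardinal.mk_real]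

/-- The functions `g / (1 + t g)`, for `t > 0`, are linearly independent if the nonnegative
function `g` takes infinitely many values. -/
theorem eq_zero_of_sum_div_eq_zero {𝕜 Z : Type*} [RCLike 𝕜] {g : Z → ℝ} (hg0 : ∀ x, 0 ≤ g x)
    (hg : (range g).Infinite) {s : Finset (Ioi (0 : ℝ))} {c : Ioi (0 : ℝ) → 𝕜}
    (h : ∀ x, ∑ t ∈ s, c t * ((g x / (1 + t * g x) : ℝ) : 𝕜) = 0) : ∀ t ∈ s, c t = 0 := by
  classical
  -- The linear relation with denominators cleared and a factor `g x` removed. It vanishes at the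
  -- infinitely many nonzero values of `g`, hence identically; evaluation at `-1 / t` isolates `c
  -- t`.
  let Q : Polynomial 𝕜 := ∑ t ∈ s, Polynomial.C (c t) *
    ∏ k ∈ s.erase t, (1 + Polynomial.C ((k : ℝ) : 𝕜) * Polynomial.X)
  have hQe : ∀ z : 𝕜, Q.eval z = ∑ t ∈ s, c t * ∏ k ∈ s.erase t, (1 + ((k : ℝ) : 𝕜) * z) := by
    intro z
    simp [Q, Polynomial.eval_finsetSum, Polynomial.eval_prod]
  have hQ : Q = 0 := by
    refine Polynomial.eq_zero_of_infinite_isRoot Q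
      (((hg.sdiff (finite_singleton 0)).image
        (RCLike.ofReal_injective (K := 𝕜)).injOn).mono ?_)
    rintro _ ⟨_, ⟨⟨x, rfl⟩, hx⟩, rfl⟩
    rw [mem_ofPred_eq, Polynomial.IsRoot.def, hQe]
    have hne : ∀ k : Ioi (0 : ℝ), (1 + (k : ℝ) * g x) ≠ 0 := fun k => by
      have h1 := hg0 x
      have h2 : (0 : ℝ) < k := k.2
      positivity
    have hne' : ∀ k : Ioi (0 : ℝ), (1 + ((k : ℝ) : 𝕜) * (g x : 𝕜)) ≠ 0 := fun k => by
      have := hne k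
      rw [← RCLike.ofReal_ne_zero (K := 𝕜)] at this
      push_cast at this
      exact this
    have hgx : (g x : 𝕜) ≠ 0 := RCLike.ofReal_ne_zero.2 hx
    have h3 : ∀ t ∈ s, c t * ∏ k ∈ s.erase t, (1 + ((k : ℝ) : 𝕜) * (g x : 𝕜)) =
        (c t * ((g x / (1 + t * g x) : ℝ) : 𝕜)) *
          ((∏ k ∈ s, (1 + ((k : ℝ) : 𝕜) * (g x : 𝕜))) / (g x : 𝕜)) := by
      intro t ht
      rw [← Finset.mul_prod_erase s _ ht]
      push_cast
      generalize ∏ k ∈ s.erase t, (1 + ((k : ℝ) : 𝕜) * (g x : 𝕜)) = R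
      have := hne' t
      generalize 1 + ((t : ℝ) : 𝕜) * (g x : 𝕜) = a at this ⊢
      field_simp
    rw [Finset.sum_congr rfl h3, ← Finset.sum_mul, h x, zero_mul]
  intro t ht
  have ht0 : ((t : ℝ) : 𝕜) ≠ 0 := RCLike.ofReal_ne_zero.2 (ne_of_gt t.2)
  have h4 := hQe (-((t : ℝ) : 𝕜)⁻¹)
  rw [hQ, Polynomial.eval_zero, Finset.sum_eq_single_of_mem t ht] at h4
  · refine (mul_eq_zero.1 h4.symm).resolve_right (Finset.prod_ne_zero_iff.2 fun k hk h0 => ?_)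
    have hkt : ((k : ℝ) : 𝕜) = (t : ℝ) := by
      field_simp at h0
      linear_combination -h0
    exact Finset.ne_of_mem_erase hk (Subtype.ext (RCLike.ofReal_injective hkt))
  · intro u hu hut
    refine mul_eq_zero_of_right _ (Finset.prod_eq_zero (Finset.mem_erase.2 ⟨hut.symm, ht⟩) ?_)
    field_simp
    ring

namespace IsLindelofPartition

variable {X : Type u} [TopologicalSpace X] {I : Type u} {p : X → I}

/-- The pieces form an open cover without proper subcover; conversely, countably many members of any
open cover suffice for each piece. -/
theorem lindelofNumber_eq (hp : IsLindelofPartition p) : lindelofNumber X = max #I ℵ₀ := by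
  set K := {n : Cardinal.{u} | ∀ 𝒰 : Set (Set X), (∀ U ∈ 𝒰, IsOpen U) → ⋃₀ 𝒰 = univ →
    ∃ 𝒱 ⊆ 𝒰, ⋃₀ 𝒱 = univ ∧ #𝒱 ≤ n} with hK
  have hlow : ∀ n ∈ K, #I ≤ n := by
    intro n hn
    obtain ⟨𝒱, h𝒱, hcov, hcard⟩ := hn (range fun i => p ⁻¹' {i})
      (by rintro _ ⟨i, rfl⟩; exact hp.isOpen_preimage _)
      (by rw [sUnion_range]; exact eq_univ_of_forall fun x => mem_iUnion.2 ⟨p x, rfl⟩)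
    have hmem : ∀ i, p ⁻¹' {i} ∈ 𝒱 := by
      intro i
      obtain ⟨x, rfl⟩ := hp.surjective i
      obtain ⟨U, hU, hxU⟩ := mem_sUnion.1 (hcov.superset (mem_univ x))
      obtain ⟨j, rfl⟩ := h𝒱 hU
      rwa [show p x = j from hxU]
    refine le_trans (Cardinal.mk_le_of_injective (f := fun i => (⟨_, hmem i⟩ : 𝒱)) ?_) hcard
    intro i j hij
    obtain ⟨x, rfl⟩ := hp.surjective i
    exact (congrArg Subtype.val hij).subset (mem_singleton (p x))
  have hup : max #I ℵ₀ ∈ K := by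
    intro 𝒰 h𝒰 hcov
    have h : ∀ i, ∃ r : Set 𝒰, r.Countable ∧ p ⁻¹' {i} ⊆ ⋃ U ∈ r, (U : Set X) := fun i =>
      (hp.isLindelof_fiber i).elim_countable_subcover (fun U : 𝒰 => (U : Set X))
        (fun U => h𝒰 U U.2) (by rw [← sUnion_eq_iUnion, hcov]; exact subset_univ _)
    choose r hr hir using h
    refine ⟨⋃ i, Subtype.val '' r i, ?_, ?_, ?_⟩
    · refine iUnion_subset fun i => ?_
      rintro _ ⟨U, -, rfl⟩
      exact U.2
    · refine eq_univ_of_forall fun x => ?_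
      obtain ⟨U, hU, hx⟩ := mem_iUnion₂.1 (hir (p x) rfl)
      exact mem_sUnion.2 ⟨U, mem_iUnion.2 ⟨p x, U, hU, rfl⟩, hx⟩
    · refine (Cardinal.mk_iUnion_le _).trans ?_
      refine (mul_le_mul_right (ciSup_le' fun i =>
        Cardinal.le_aleph0_iff_set_countable.2 ((hr i).image _)) _).trans ?_
      exact Cardinal.mul_le_max_of_aleph0_le_right le_rfl
  have h1 : sInf K ≤ max #I ℵ₀ := csInf_le' hup
  have h2 : #I ≤ sInf K := le_csInf ⟨_, hup⟩ hlow
  change sInf K + ℵ₀ = _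
  rw [Cardinal.add_eq_max' le_rfl]
  exact le_antisymm (max_le h1 (le_max_right _ _)) (max_le_max_right _ h2)

variable (𝕜 : Type) [RCLike 𝕜]

/-- Each piece is separable, so a function is determined by its values on countable dense subsets of
the pieces, and only countably many of these values are nonzero. -/
theorem mk_lindelofSupported_le [TopologicalSpace.MetrizableSpace X]
    (hp : IsLindelofPartition p) : #(lindelofSupported 𝕜 X) ≤ max #I ℵ₀ ^ (ℵ₀ : Cardinal.{u}) := by
  let _ := TopologicalSpace.metrizableSpaceMetric X
  have hd : ∀ i, ∃ d : ℕ → X, (∀ n, p (d n) = i) ∧ p ⁻¹' {i} ⊆ closure (range d) := by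
    intro i
    obtain ⟨D, hDi, hD, hiD⟩ := (hp.isLindelof_fiber i).exists_countable_dense
    obtain ⟨x, hx⟩ := hp.surjective i
    obtain ⟨d, rfl⟩ := hD.exists_eq_range (closure_nonempty_iff.1 ⟨x, hiD hx⟩)
    exact ⟨d, fun n => hDi (mem_range_self n), hiD⟩
  choose d hdp hd using hd
  let Φ : lindelofSupported 𝕜 X → {t : Set ((I × ℕ) × 𝕜) // #t ≤ ℵ₀} := fun f =>
    ⟨{a | f.1 (d a.1.1 a.1.2) = a.2 ∧ a.2 ≠ 0}, by
      obtain ⟨J, hJ, hfJ⟩ := hp.mem_lindelofSupported_iff.1 f.2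
      rw [Cardinal.le_aleph0_iff_set_countable]
      refine ((hJ.prod (countable_univ (α := ℕ))).image
        fun b => (b, f.1 (d b.1 b.2))).mono ?_
      rintro ⟨⟨i, n⟩, z⟩ ⟨hfz, hz⟩
      refine ⟨(i, n), ⟨?_, mem_univ _⟩, Prod.ext rfl hfz⟩
      by_contra hi
      exact hz (hfz.symm.trans (hfJ _ (by rwa [hdp])))⟩
  have hΦ : Function.Injective Φ := by
    intro f g hfg
    have h1 : ∀ i n z, (f.1 (d i n) = z ∧ z ≠ 0) ↔ (g.1 (d i n) = z ∧ z ≠ 0) := fun i n z =>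
      Set.ext_iff.1 (congrArg Subtype.val hfg) ((i, n), z)
    have h2 : ∀ i n, f.1 (d i n) = g.1 (d i n) := by
      intro i n
      by_cases hf : f.1 (d i n) = 0
      · by_contra hg
        rw [hf] at hg
        have := ((h1 i n _).2 ⟨rfl, Ne.symm hg⟩).1
        exact hg (hf.symm.trans this)
      · exact ((h1 i n _).1 ⟨rfl, hf⟩).1.symm
    refine Subtype.ext (BoundedContinuousFunction.ext fun x => ?_)
    refine closure_minimal (s := range (d (p x))) (t := {x | f.1 x = g.1 x}) ?_
      (isClosed_eq f.1.continuous g.1.continuous) (hd (p x) rfl)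
    rintro _ ⟨n, rfl⟩
    exact h2 _ n
  set ℓ := max #I ℵ₀
  have hℓ : ℵ₀ ≤ ℓ := le_max_right _ _
  have hℓp : ℓ ≤ ℓ ^ (ℵ₀ : Cardinal.{u}) := Cardinal.self_le_power _ Cardinal.one_le_aleph0
  have hcont : (𝔠 : Cardinal.{u}) ≤ ℓ ^ (ℵ₀ : Cardinal.{u}) := by
    rw [← Cardinal.aleph0_power_aleph0]
    exact Cardinal.power_le_power_right hℓ
  have hcard : #((I × ℕ) × 𝕜) ≤ ℓ ^ (ℵ₀ : Cardinal.{u}) := by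
    rw [Cardinal.mk_prod, Cardinal.mk_prod]
    refine Cardinal.mul_le_of_le (hℓ.trans hℓp) ?_ ?_
    · simpa using (Cardinal.mul_le_of_le hℓ (le_max_left _ _) hℓ).trans hℓp
    · exact (Cardinal.lift_le.2 (RCLike.mk_le_continuum 𝕜)).trans (by simpa using hcont)
  calc #(lindelofSupported 𝕜 X) ≤ _ := Cardinal.mk_le_of_injective hΦ
    _ ≤ max #((I × ℕ) × 𝕜) ℵ₀ ^ (ℵ₀ : Cardinal.{u}) := Cardinal.mk_bounded_set_le _ _
    _ ≤ (ℓ ^ (ℵ₀ : Cardinal.{u})) ^ (ℵ₀ : Cardinal.{u}) :=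
      Cardinal.power_le_power_right (max_le hcard (hℓ.trans hℓp))
    _ = ℓ ^ (ℵ₀ : Cardinal.{u}) := by rw [← Cardinal.power_mul, Cardinal.aleph0_mul_aleph0]

theorem le_mk_lindelofSupported (hp : IsLindelofPartition p) :
    #I ^ (ℵ₀ : Cardinal.{u}) ≤ #(lindelofSupported 𝕜 X) := by
  classical
  -- The value on the piece `i` encodes the set of positions where `s` equals `i`, so the function
  -- determines `s`. The ratio `1 / 3` is below `1 / 2`, which makes the coding injective.
  let φ : (ℕ → I) → I → ℝ := fun s i => Cardinal.cantorFunction (1 / 3) fun n => decide (s n = i)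
  have hφ0 : ∀ s i, 0 ≤ φ s i := fun s i =>
    tsum_nonneg fun n => Cardinal.cantorFunctionAux_nonneg (by norm_num)
  have hφ1 : ∀ s i, φ s i ≤ Cardinal.cantorFunction (1 / 3) fun _ => true := fun s i =>
    Cardinal.cantorFunction_le (by norm_num) (by norm_num) fun _ _ => rfl
  let F : (ℕ → I) → lindelofSupported 𝕜 X := fun s =>
    ⟨hp.ofPieces 𝕜 (fun i => (φ s i : 𝕜)) _ (fun i => by
      rw [RCLike.norm_ofReal, abs_of_nonneg (hφ0 s i)]
      exact hφ1 s i),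
      hp.mem_lindelofSupported_iff.2 ⟨range s, countable_range s, fun x hx => by
        have : φ s (p x) = 0 := by
          have h : (fun n => decide (s n = p x)) = fun _ => false := by
            funext n
            exact decide_eq_false fun h => hx ⟨n, h⟩
          simp only [φ, h, Cardinal.cantorFunction, Cardinal.cantorFunctionAux_false, tsum_zero]
        change ((φ s (p x) : ℝ) : 𝕜) = 0
        rw [this, RCLike.ofReal_zero]⟩⟩
  have hF : Function.Injective F := by
    intro s t hst
    funext n
    obtain ⟨x, hx⟩ := hp.surjective (s n)
    have h1 : ((φ s (p x) : ℝ) : 𝕜) = (φ t (p x) : ℝ) :=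
      congrArg (fun f : lindelofSupported 𝕜 X => f.1 x) hst
    have h2 := congrFun (Cardinal.cantorFunction_injective (by norm_num) (by norm_num)
      (RCLike.ofReal_injective h1)) n
    simp only [hx, decide_true] at h2
    exact (of_decide_eq_true h2.symm).symm
  have := Cardinal.mk_le_of_injective hF
  simpa using this

theorem exists_infinite_range [TopologicalSpace.MetrizableSpace X] [Infinite X]
    (hp : IsLindelofPartition p) : ∃ g : X → ℝ, Continuous g ∧ (∀ x, 0 ≤ g x) ∧
      (range g).Infinite ∧ (∃ C, ∀ x, g x ≤ C) ∧
      ∃ J : Set I, J.Countable ∧ ∀ x, p x ∉ J → g x = 0 := by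
  classical
  let _ := TopologicalSpace.metrizableSpaceMetric X
  by_cases hX : ∀ x : X, IsOpen {x}
  · have := discreteTopology_iff_isOpen_singleton.2 hX
    let e := Infinite.natEmbedding X
    let g : X → ℝ := Function.extend e (fun n => 1 / ((n : ℝ) + 1)) 0
    have hge : ∀ n, g (e n) = 1 / ((n : ℝ) + 1) := fun n => e.injective.extend_apply _ _ n
    have hg0 : ∀ x, x ∉ range e → g x = 0 := fun x hx => Function.extend_apply' _ _ x hx
    refine ⟨g, continuous_of_discreteTopology, fun x => ?_, ?_, ⟨1, fun x => ?_⟩,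
      p '' range e, (countable_range e).image p, fun x hx => hg0 x fun h => hx ⟨x, h, rfl⟩⟩
    · by_cases hx : x ∈ range e
      · obtain ⟨n, rfl⟩ := hx
        rw [hge]
        positivity
      · rw [hg0 x hx]
    · refine (infinite_range_of_injective (f := fun n => g (e n)) fun m n hmn => ?_).mono
        (range_comp_subset_range e g)
      simp only [hge] at hmn
      have h1 : (0 : ℝ) < m + 1 := by positivity
      have h2 : (0 : ℝ) < n + 1 := by positivity
      field_simp at hmn
      exact_mod_cast (add_right_cancel hmn).symm
    · by_cases hx : x ∈ range e
      · obtain ⟨n, rfl⟩ := hx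
        rw [hge, div_le_one (by positivity)]
        linarith [(Nat.cast_nonneg n : (0 : ℝ) ≤ n)]
      · rw [hg0 x hx]
        exact zero_le_one
  · push Not at hX
    obtain ⟨x₀, hx₀⟩ := hX
    -- The truncated distance to a nonisolated point, cut off to its piece. With finite range, its
    -- zero set within that piece, namely `{x₀}`, would be open.
    let g : X → ℝ := fun x => (if p x = p x₀ then 1 else 0) * min 1 (dist x x₀)
    have hg : Continuous g := (hp.continuous_comp fun i => if i = p x₀ then (1 : ℝ) else 0).mul
      (continuous_const.min (continuous_id.dist continuous_const))
    have hm : ∀ x, 0 ≤ min 1 (dist x x₀) := fun x => le_min zero_le_one dist_nonneg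
    refine ⟨g, hg, fun x => mul_nonneg (by split_ifs <;> norm_num) (hm x), fun hfin => hx₀ ?_,
      ⟨1, fun x => ?_⟩, {p x₀}, countable_singleton _, fun x hx => ?_⟩
    · have h1 : IsOpen (g ⁻¹' (range g \ {0})ᶜ) :=
        (hfin.subset sdiff_subset).isClosed.isOpen_compl.preimage hg
      convert h1.inter (hp.isOpen_preimage {p x₀}) using 1
      ext x
      constructor
      · rintro rfl
        refine ⟨fun h => h.2 ?_, rfl⟩
        simp [g]
      · rintro ⟨h, hx : p x = p x₀⟩
        have h0 : g x = 0 := by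
          by_contra h0
          exact h ⟨mem_range_self x, h0⟩
        simp only [g, if_pos hx, one_mul] at h0
        rcases min_choice 1 (dist x x₀) with h | h
        · rw [h] at h0
          exact absurd h0 one_ne_zero
        · rw [h] at h0
          exact dist_eq_zero.1 h0
    · refine mul_le_one₀ (by split_ifs <;> norm_num) (hm x) (min_le_left _ _)
    · simp [g, show p x ≠ p x₀ from hx]

theorem continuum_le_rank [TopologicalSpace.MetrizableSpace X] [Infinite X]
    (hp : IsLindelofPartition p) : 𝔠 ≤ Module.rank 𝕜 (lindelofSupported 𝕜 X) := by
  obtain ⟨g, hg, hg0, hgi, ⟨C, hC⟩, J, hJ, hgJ⟩ := hp.exists_infinite_range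
  have hne : ∀ (t : Ioi (0 : ℝ)) x, 1 ≤ 1 + (t : ℝ) * g x := fun t x =>
    le_add_of_nonneg_right (mul_nonneg (le_of_lt t.2) (hg0 x))
  let F : Ioi (0 : ℝ) → lindelofSupported 𝕜 X := fun t =>
    ⟨BoundedContinuousFunction.ofNormedAddCommGroup
      (fun x => ((g x / (1 + t * g x) : ℝ) : 𝕜))
      (RCLike.continuous_ofReal.comp (hg.div (continuous_const.add (continuous_const.mul hg))
        fun x => (zero_lt_one.trans_le (hne t x)).ne')) C
      (fun x => by
        rw [RCLike.norm_ofReal, abs_of_nonneg (div_nonneg (hg0 x) (zero_le_one.trans (hne t x)))]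
        exact (div_le_self (hg0 x) (hne t x)).trans (hC x)),
      hp.mem_lindelofSupported_iff.2 ⟨J, hJ, fun x hx => by
        change ((g x / (1 + t * g x) : ℝ) : 𝕜) = 0
        rw [hgJ x hx, zero_div, RCLike.ofReal_zero]⟩⟩
  have hF : LinearIndependent 𝕜 F := by
    rw [linearIndependent_iff']
    intro s c hsc
    refine eq_zero_of_sum_div_eq_zero hg0 hgi fun x => ?_
    let ev : lindelofSupported 𝕜 X →+ 𝕜 := ⟨⟨fun f => f.1 x, rfl⟩, fun _ _ => rfl⟩
    have h1 := congrArg ev hsc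
    rw [map_sum, map_zero] at h1
    exact h1
  have := hF.cardinal_lift_le_rank
  simpa [Cardinal.mk_Ioi_real] using this

/-- An infinite-dimensional space has cardinality the maximum of its dimension and `#𝕜`; as the
dimension is at least `𝔠 ≥ #𝕜`, it equals the cardinality. -/
theorem rank_lindelofSupported [TopologicalSpace.MetrizableSpace X] [Infinite X]
    (hp : IsLindelofPartition p) :
    Module.rank 𝕜 (lindelofSupported 𝕜 X) = lindelofNumber X ^ (ℵ₀ : Cardinal.{u}) := by
  have hc := hp.continuum_le_rank 𝕜
  let b := Module.Free.chooseBasis 𝕜 (lindelofSupported 𝕜 X)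
  have hb := b.mk_eq_rank''
  have : Infinite (Module.Free.ChooseBasisIndex 𝕜 (lindelofSupported 𝕜 X)) := by
    rw [Cardinal.infinite_iff, hb]
    exact Cardinal.aleph0_le_continuum.trans hc
  have hV : #(lindelofSupported 𝕜 X) = Module.rank 𝕜 (lindelofSupported 𝕜 X) := by
    rw [Cardinal.mk_congr b.repr.toEquiv, Cardinal.mk_finsupp_lift_of_infinite, hb,
      Cardinal.lift_uzero]
    refine max_eq_left (le_trans ?_ hc)
    exact (Cardinal.lift_le.2 (RCLike.mk_le_continuum 𝕜)).trans (by simp)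
  rw [← hV, hp.lindelofNumber_eq]
  refine le_antisymm (hp.mk_lindelofSupported_le 𝕜) ?_
  -- When there are at most `ℵ₀` pieces, the target is `ℵ₀ ^ ℵ₀ = 𝔠`, and the bound on the rank
  -- suffices.
  rcases le_total #I ℵ₀ with h | h
  · rw [max_eq_right h, Cardinal.aleph0_power_aleph0, hV]
    exact hc
  · rw [max_eq_left h]
    exact hp.le_mk_lindelofSupported 𝕜

end IsLindelofPartition

end Dimension

theorem theorem4p6 (𝕜 : Type) [RCLike 𝕜] (X : Type u) [TopologicalSpace X]
    [TopologicalSpace.MetrizableSpace X] (hX : IsLocallyLindelof X) :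
    -- `C_𝒫(X)`, a subalgebra of `C_b(X)` with the supremum norm, is complete
    CompleteSpace (lindelofSupported 𝕜 X) ∧
    -- `Y = λ_𝒫 X` is locally compact Hausdorff and `C_𝒫(X)` is isometrically isomorphic to `C_c(Y)`
    T2Space (lambdaLindelof 𝕜 X) ∧ LocallyCompactSpace (lambdaLindelof 𝕜 X) ∧
    IsometricallyIsomorphic 𝕜 (lindelofSupported 𝕜 X)
      (compactSupported 𝕜 (lambdaLindelof 𝕜 X)) ∧
    -- `Y` is the only such space, up to homeomorphism
    (∀ (T : Type v) [TopologicalSpace T] [T2Space T] [LocallyCompactSpace T],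
      IsometricallyIsomorphic 𝕜 (lindelofSupported 𝕜 X) (compactSupported 𝕜 T) →
        Nonempty (T ≃ₜ lambdaLindelof 𝕜 X)) ∧
    -- `C_𝒫(X)` consists of the functions with Lindelöf support
    (lindelofSupported 𝕜 X : Set (X →ᵇ 𝕜)) =
      {f : X →ᵇ 𝕜 | IsLindelof (tsupport f)} ∧
    -- it contains `C_0(X)`, properly if `X` is not Lindelöf
    vanishingAtInfinity 𝕜 X ⊆ (lindelofSupported 𝕜 X : Set (X →ᵇ 𝕜)) ∧
    (¬ LindelofSpace X →
      vanishingAtInfinity 𝕜 X ⊂ (lindelofSupported 𝕜 X : Set (X →ᵇ 𝕜))) ∧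
    -- `C_c(Y) = C_0(Y)`
    (compactSupported 𝕜 (lambdaLindelof 𝕜 X) : Set (lambdaLindelof 𝕜 X →ᵇ 𝕜)) =
      vanishingAtInfinity 𝕜 (lambdaLindelof 𝕜 X) ∧
    -- `Y` is countably compact
    CountablyCompactSpace (lambdaLindelof 𝕜 X) ∧
    -- `Y` is not normal if `X` is not Lindelöf
    (¬ LindelofSpace X → ¬ NormalSpace (lambdaLindelof 𝕜 X)) ∧
    -- the dimension (a Hamel dimension, as a cardinal); finite `X` is excluded
    (Infinite X → Module.rank 𝕜 (lindelofSupported 𝕜 X) = lindelofNumber X ^ ℵ₀) := by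
  let _ := TopologicalSpace.metrizableSpaceMetric X
  obtain ⟨I, p, hp⟩ := hX.exists_partition
  have hloc : LocallyCompactSpace (lambdaLindelof 𝕜 X) :=
    (isOpen_lambdaLindelof 𝕜).locallyCompactSpace
  refine ⟨hp.completeSpace_lindelofSupported 𝕜, inferInstance, hloc,
    hp.isometricallyIsomorphic 𝕜, ?_, hp.lindelofSupported_eq 𝕜,
    hp.vanishingAtInfinity_subset 𝕜, hp.vanishingAtInfinity_ssubset 𝕜,
    hp.compactSupported_lambdaLindelof_eq 𝕜, hp.countablyCompactSpace_lambdaLindelof 𝕜,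
    hp.not_normalSpace 𝕜, fun _ => hp.rank_lindelofSupported 𝕜⟩
  -- Uniqueness needs only an algebra isomorphism; preservation of the norm is discarded.
  rintro T _ _ _ ⟨φ, hφ, -⟩
  exact nonempty_homeomorph_of_bijective (φ.comp (hp.restrictHom 𝕜))
    (hφ.comp ⟨hp.restrictHom_injective 𝕜, hp.restrictHom_surjective 𝕜⟩)
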